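/- A convex object in $\mathbb{R}^2$ is a compact convex set with nonempty interior. Let $\mathcal{S}$ be the family of all translates of a convex object in $\mathbb{R}^2$. The independent kissing number $\zeta$ of $\mathcal{S}$ is the maximum, over all $u\in\mathcal{S}$, of the number of pairwise disjoint members of $\mathcal{S}$ that all intersect $u$ (this maximum exists). Consider the online minimum connected dominating set (MCDS) problem on $\mathcal{S}$. The input is a finite sequence of distinct members of $\mathcal{S}$, revealed one at a time, such that the intersection graph of the objects revealed so far (two objects being adjacent when they intersect) is connected at every time. After each arrival a deterministic online algorithm, which knows only the objects revealed so far, must hold a connected dominating set of the current intersection graph; at any time it may add any objects revealed so far to its solution, but it can never remove an object. Its (absolute) competitive ratio is the smallest $c$ (or $+\infty$ if there is none) such that, on every input, the size of its final solution is at most $c$ times the minimum size of a connected dominating set of the intersection graph of the whole input. Then every deterministic online algorithm for MCDS on $\mathcal{S}$ has competitive ratio at least $2(\zeta-1)$. -/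

import Mathlib

open Set

/-- The Euclidean plane. -/
abbrev Plane : Type := EuclideanSpace ℝ (Fin 2)

/-- A (convex) geometric object: a compact convex set with nonempty interior. -/
structure IsConvexObject (C : Set Plane) : Prop where
  compact : IsCompact C
  convex : Convex ℝ C
  interior_nonempty : (interior C).Nonempty

/-- The family of all translated copies of `C`. -/
def translates (C : Set Plane) : Set (Set Plane) :=
  {σ | ∃ v : Plane, σ = (fun x => v + x) '' C}

/-- The geometric intersection graph of a family `S`: its vertices are the members of `S`, and two
distinct members are adjacent iff they have a common point. -/
def intersectionGraph (S : Set (Set Plane)) : SimpleGraph S where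
  Adj u v := u ≠ v ∧ ((u : Set Plane) ∩ (v : Set Plane)).Nonempty
  symm := ⟨fun _ _ h => ⟨h.1.symm, by rw [Set.inter_comm]; exact h.2⟩⟩
  loopless := ⟨fun _ h => h.1 rfl⟩

/-- `n` pairwise disjoint ("non-touching") members of `S` can all be intersected by the member `u`
of `S`. -/
def HasIndependentKissing (S : Set (Set Plane)) (u : Set Plane) (n : ℕ) : Prop :=
  ∃ I : Finset (Set Plane), (∀ σ ∈ I, σ ∈ S) ∧
    (∀ σ ∈ I, ∀ τ ∈ I, σ ≠ τ → Disjoint σ τ) ∧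
    (∀ σ ∈ I, (u ∩ σ).Nonempty) ∧ I.card = n

/-- `ζ` is the independent kissing number of `S`: the maximum, over the members `u` of `S`, of the
number of pairwise disjoint members of `S` that are all intersected by `u`. -/
def IsIndependentKissingNumber (S : Set (Set Plane)) (ζ : ℕ) : Prop :=
  IsGreatest {n | ∃ u ∈ S, HasIndependentKissing S u n} ζ

section MCDS

variable {V : Type*}

/-- `D` is a connected dominating set of the subgraph of `G` induced by the set `U` of vertices.
(It is used only for sets `U` that induce a connected subgraph. `Preconnected` rather than
`Connected`, so that the empty graph has the empty set as a connected dominating set; `D` is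
automatically nonempty when `U` is.) -/
def IsCDS (G : SimpleGraph V) (U : Set V) (D : Finset V) : Prop :=
  (D : Set V) ⊆ U ∧
    (∀ v ∈ U, v ∈ D ∨ ∃ u ∈ D, G.Adj u v) ∧
    (G.induce (D : Set V)).Preconnected

/-- The admissible input sequences of the online problem on `G`: finite sequences of distinct
vertices such that the subgraph revealed so far is connected at every time. -/
def IsOnlineInput (G : SimpleGraph V) (I : List V) : Prop :=
  I.Nodup ∧ ∀ J : List V, J <+: I → (G.induce {v | v ∈ J}).Preconnected

/-- A deterministic online algorithm for the minimum connected dominating set problem on input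
sequences of vertices of `G`, in the relaxed (late accept) model. `sol I` is the solution held after
the sequence `I` has been revealed. It is a function of that sequence only, a vertex once accepted
is never dropped, any vertex revealed so far may be accepted at any time, and the solution is a
connected dominating set of the revealed graph after every arrival. -/
structure OnlineCDSAlgorithm (G : SimpleGraph V) where
  sol : List V → Finset V
  irrevocable : ∀ (I : List V) (v : V), IsOnlineInput G (I ++ [v]) → sol I ⊆ sol (I ++ [v])
  feasible : ∀ I : List V, IsOnlineInput G I → IsCDS G {v | v ∈ I} (sol I)

/-- The offline optimum: the smallest cardinality of a connected dominating set of the subgraph of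
`G` induced by the vertices of `I`. -/
noncomputable def optCDS (G : SimpleGraph V) (I : List V) : ℕ :=
  sInf {n | ∃ D : Finset V, IsCDS G {v | v ∈ I} D ∧ D.card = n}

/-- `A` is `c`-competitive in the absolute (strict) sense: its cost is at most `c` times the
offline optimum on every admissible input, without an additive constant. -/
def OnlineCDSAlgorithm.IsCompetitive {G : SimpleGraph V} (A : OnlineCDSAlgorithm G) (c : ℝ) :
    Prop :=
  ∀ I : List V, IsOnlineInput G I → ((A.sol I).card : ℝ) ≤ c * (optCDS G I : ℝ)

/-- The (absolute) competitive ratio of `A`: the smallest `c` for which `A` is `c`-competitive, and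
`⊤` if there is none. -/
noncomputable def OnlineCDSAlgorithm.competitiveRatio {G : SimpleGraph V}
    (A : OnlineCDSAlgorithm G) : EReal :=
  sInf {r : EReal | ∃ c : ℝ, A.IsCompetitive c ∧ r = (c : EReal)}

end MCDS

/-! Let `N` be the norm whose unit ball is the difference body `C - C`: the translates of `C` by `v`
and `w` meet iff `N (v - w) ≤ 1`. The adversary reveals an induced path of translates by unit
vectors (`IsUnitPath`) and then the untranslated copy, which meets all of them. Along the path every
vertex but the last is forced into the solution (`IsInducedPath.mem_sol`), while the hub alone
dominates at the end, so a path on `m` vertices forces ratio at least `m - 1`.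

It remains to find long paths. Disjoint kissing translates yield unit vectors at pairwise distance
above one. A hexagon with a vertex at one of them leaves four sectors for the others, at most one in
each, so `ζ ≤ 5`. Every norm has a path of seven unit vectors, part of an octagon
(`exists_unitPath_seven`), and the resulting bound 6 settles `ζ ≤ 4`. If `ζ = 5`, the five vectors
and their antipodes form an induced 10-cycle; deleting a vertex leaves a path of nine
(`exists_unitPath_nine`) and the bound 8. -/

/-! ### Norm estimates in the cone of two unit vectors at distance at most one. -/

section Sectors

variable {E : Type*} [AddCommGroup E] [Module ℝ E] (N : Seminorm ℝ E)

theorem Seminorm.map_smul_add_smul_le {α β : ℝ} (hα : 0 ≤ α) (hβ : 0 ≤ β) (x y : E) :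
    N (α • x + β • y) ≤ α * N x + β * N y := by
  refine (map_add_le_add N _ _).trans ?_
  rw [map_smul_eq_mul, map_smul_eq_mul, Real.norm_of_nonneg hα, Real.norm_of_nonneg hβ]

variable {N}

/-- The closed convex cone spanned by two vectors. -/
def InSector (a b x : E) : Prop := ∃ s t : ℝ, 0 ≤ s ∧ 0 ≤ t ∧ x = s • a + t • b

theorem InSector.symm {a b x : E} : InSector a b x → InSector b a x := by
  rintro ⟨s, t, hs, ht, rfl⟩
  exact ⟨t, s, ht, hs, add_comm _ _⟩

theorem InSector.left (a b : E) : InSector a b a := ⟨1, 0, by simp, by simp, by simp⟩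

theorem InSector.right (a b : E) : InSector a b b := ⟨0, 1, by simp, by simp, by simp⟩

/-- The ray of `u + v` separates the two cones. A suitable multiple of `x` cancels the
`u`-coordinate of `y` and leaves a nonnegative multiple of `v`. -/
theorem InSector.of_adjacent {u v x y : E} (hx : x ≠ 0) (h : InSector u (u + v) x)
    (h' : InSector (u + v) v y) : InSector x v y := by
  obtain ⟨s, t, hs, ht, rfl⟩ := h
  obtain ⟨s', t', hs', ht', rfl⟩ := h'
  have hst : 0 < s + t := by
    refine lt_of_le_of_ne (by positivity) fun h0 => hx ?_
    have hs0 : s = 0 := by linarith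
    have ht0 : t = 0 := by linarith
    simp [hs0, ht0]
  obtain ⟨r, hr, rfl⟩ : ∃ r, 0 ≤ r ∧ s' = r * (s + t) :=
    ⟨s' / (s + t), by positivity, (div_mul_cancel₀ _ hst.ne').symm⟩
  exact ⟨r, r * s + t', hr, by positivity, by module⟩

theorem Seminorm.le_map_sector_left {a b : E} (ha : N a = 1) (hab : N (a - b) ≤ 1) {s t : ℝ}
    (hs : 0 ≤ s) (ht : 0 ≤ t) : s ≤ N (s • a + t • b) := by
  have h1 : N ((s + t) • a) = s + t := by
    rw [map_smul_eq_mul, Real.norm_of_nonneg (by positivity), ha, mul_one]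
  have h2 : (s + t) • a = (1 : ℝ) • (s • a + t • b) + t • (a - b) := by module
  have h3 := N.map_smul_add_smul_le zero_le_one ht (s • a + t • b) (a - b)
  rw [← h2, h1] at h3
  nlinarith

theorem Seminorm.le_map_sector_right {a b : E} (hb : N b = 1) (hab : N (a - b) ≤ 1) {s t : ℝ}
    (hs : 0 ≤ s) (ht : 0 ≤ t) : t ≤ N (s • a + t • b) := by
  rw [add_comm]
  exact Seminorm.le_map_sector_left hb (by rwa [map_sub_rev]) ht hs

/-- The vector on the left is a convex combination of the one on the right and of `t • b`, whose
norm `t` is no larger by `le_map_sector_right`. -/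
theorem Seminorm.map_sector_mono_left {a b : E} (hb : N b = 1) (hab : N (a - b) ≤ 1)
    {r s t : ℝ} (hr : 0 ≤ r) (hrs : r ≤ s) (ht : 0 ≤ t) :
    N (r • a + t • b) ≤ N (s • a + t • b) := by
  rcases (hr.trans hrs).eq_or_lt with h0 | h0
  · have : r = s := by linarith
    rw [this]
  have h1 : N (s • (r • a + t • b)) = s * N (r • a + t • b) := by
    rw [map_smul_eq_mul, Real.norm_of_nonneg h0.le]
  have h2 : s • (r • a + t • b) = r • (s • a + t • b) + ((s - r) * t) • b := by module
  have h3 := N.map_smul_add_smul_le hr (mul_nonneg (sub_nonneg.2 hrs) ht) (s • a + t • b) b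
  rw [← h2, h1, hb] at h3
  have h4 := Seminorm.le_map_sector_right hb hab h0.le ht
  have h5 := mul_le_mul_of_nonneg_left h4 (sub_nonneg.2 hrs)
  refine le_of_mul_le_mul_left ?_ h0
  linarith

theorem Seminorm.map_sector_mono {a b : E} (ha : N a = 1) (hb : N b = 1) (hab : N (a - b) ≤ 1)
    {r s t u : ℝ} (hr : 0 ≤ r) (hrs : r ≤ s) (ht : 0 ≤ t) (htu : t ≤ u) :
    N (r • a + t • b) ≤ N (s • a + u • b) := by
  refine (Seminorm.map_sector_mono_left hb hab hr hrs ht).trans ?_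
  rw [add_comm, add_comm (s • a)]
  exact Seminorm.map_sector_mono_left ha (by rwa [map_sub_rev]) ht htu (hr.trans hrs)

theorem Seminorm.map_smul_sub_smul_le_one {a b : E} (ha : N a = 1) (hab : N (a - b) ≤ 1)
    {s t : ℝ} (ht : 0 ≤ t) (hts : t ≤ s) (hs : s ≤ 1) : N (s • a - t • b) ≤ 1 := by
  have h2 : s • a - t • b = t • (a - b) + (s - t) • a := by module
  have h3 := N.map_smul_add_smul_le ht (sub_nonneg.2 hts) (a - b) a
  rw [← h2, ha] at h3
  nlinarith

theorem Seminorm.map_smul_sub_smul_le_one' {a b : E} (ha : N a = 1) (hb : N b = 1)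
    (hab : N (a - b) ≤ 1) {s t : ℝ} (hs : 0 ≤ s) (ht : 0 ≤ t) (hs1 : s ≤ 1) (ht1 : t ≤ 1) :
    N (s • a - t • b) ≤ 1 := by
  rcases le_total t s with h | h
  · exact Seminorm.map_smul_sub_smul_le_one ha hab ht h hs1
  · rw [map_sub_rev]
    exact Seminorm.map_smul_sub_smul_le_one hb (by rwa [map_sub_rev]) hs h ht1

/-- Two points of the unit ball in the cone of two unit vectors at distance at most one are at
distance at most one. -/
theorem Seminorm.map_sub_le_one_of_inSector {a b x y : E} (ha : N a = 1) (hb : N b = 1)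
    (hab : N (a - b) ≤ 1) (hx : InSector a b x) (hy : InSector a b y) (hx1 : N x ≤ 1)
    (hy1 : N y ≤ 1) : N (x - y) ≤ 1 := by
  obtain ⟨s, t, hs, ht, rfl⟩ := hx
  obtain ⟨s', t', hs', ht', rfl⟩ := hy
  have h1 := Seminorm.le_map_sector_left ha hab hs ht
  have h2 := Seminorm.le_map_sector_right hb hab hs ht
  have h3 := Seminorm.le_map_sector_left ha hab hs' ht'
  have h4 := Seminorm.le_map_sector_right hb hab hs' ht'
  -- Coordinate differences of equal sign are handled by monotonicity of `N` on the cone; for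
  -- opposite signs it suffices that all coordinates lie in `[0, 1]`.
  rcases le_total s s' with h | h <;> rcases le_total t t' with h' | h'
  · rw [map_sub_rev]
    have e : s' • a + t' • b - (s • a + t • b) = (s' - s) • a + (t' - t) • b := by module
    rw [e]
    exact (Seminorm.map_sector_mono ha hb hab (by linarith) (by linarith) (by linarith)
      (by linarith)).trans hy1
  · rw [map_sub_rev]
    have e : s' • a + t' • b - (s • a + t • b) = (s' - s) • a - (t - t') • b := by module
    rw [e]
    exact Seminorm.map_smul_sub_smul_le_one' ha hb hab (by linarith) (by linarith) (by linarith)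
      (by linarith)
  · have e : s • a + t • b - (s' • a + t' • b) = (s - s') • a - (t' - t) • b := by module
    rw [e]
    exact Seminorm.map_smul_sub_smul_le_one' ha hb hab (by linarith) (by linarith) (by linarith)
      (by linarith)
  · have e : s • a + t • b - (s' • a + t' • b) = (s - s') • a + (t - t') • b := by module
    rw [e]
    exact (Seminorm.map_sector_mono ha hb hab (by linarith) (by linarith) (by linarith)
      (by linarith)).trans hx1

/-- Pushing two far apart points of the unit ball to the unit sphere keeps them far apart. -/
theorem Seminorm.one_lt_map_normalize_sub {x y : E} (hx : 0 < N x) (hy : 0 < N y) (hx1 : N x ≤ 1)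
    (hy1 : N y ≤ 1) (h : 1 < N (x - y)) : 1 < N ((N x)⁻¹ • x - (N y)⁻¹ • y) := by
  by_contra! hc
  have hX : N ((N x)⁻¹ • x) = 1 := by
    rw [map_smul_eq_mul, Real.norm_of_nonneg (by positivity), inv_mul_cancel₀ hx.ne']
  have hY : N ((N y)⁻¹ • y) = 1 := by
    rw [map_smul_eq_mul, Real.norm_of_nonneg (by positivity), inv_mul_cancel₀ hy.ne']
  have := Seminorm.map_smul_sub_smul_le_one' hX hY hc hx.le hy.le hx1 hy1
  rw [smul_inv_smul₀ hx.ne', smul_inv_smul₀ hy.ne'] at this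
  linarith

end Sectors

/-! ### Separated unit vectors in a normed plane. -/

section PlaneNorm

variable {N : Seminorm ℝ Plane}

theorem isPreconnected_compl_zero_plane : IsPreconnected ({0}ᶜ : Set Plane) := by
  refine (isConnected_compl_singleton_of_one_lt_rank ?_ 0).isPreconnected
  rw [← Module.finrank_eq_rank]
  simp

/-- Intermediate value theorem on the unit circle, applied to `F` after radial projection from the
connected punctured plane. -/
theorem Seminorm.exists_unit_eq (hN : ∀ x, N x = 0 → x = 0) (hc : Continuous N) {F : Plane → ℝ}
    (hF : Continuous F) {a : Plane} (ha : N a = 1) {r : ℝ} (h1 : F a ≤ r) (h2 : r ≤ F (-a)) :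
    ∃ b, N b = 1 ∧ F b = r := by
  have ha0 : a ≠ 0 := by rintro rfl; simp at ha
  have hcont : ContinuousOn (fun x => F ((N x)⁻¹ • x)) ({0}ᶜ : Set Plane) := by
    refine hF.comp_continuousOn (ContinuousOn.smul (hc.continuousOn.inv₀ ?_) continuousOn_id)
    intro x hx h
    exact hx (hN x h)
  obtain ⟨x, hx, hxr⟩ := isPreconnected_compl_zero_plane.intermediate_value (a := a) (b := -a)
    (by simpa using ha0) (by simpa using ha0) hcont (show r ∈ Icc _ _ by simp [ha, h1, h2])
  have hx0 : N x ≠ 0 := fun h => hx (hN x h)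
  refine ⟨_, ?_, hxr⟩
  rw [map_smul_eq_mul, Real.norm_of_nonneg (inv_nonneg.2 (apply_nonneg N x)), inv_mul_cancel₀ hx0]

theorem Seminorm.map_two_smul (x : Plane) : N ((2 : ℝ) • x) = 2 * N x := by
  rw [map_smul_eq_mul, Real.norm_of_nonneg zero_le_two]

theorem Seminorm.map_neg_sub_self (x : Plane) : N (-x - x) = 2 * N x := by
  rw [← N.map_two_smul, ← map_neg_eq_map]
  congr 1
  module

theorem exists_smul_add_smul_of_unit {a b : Plane} (ha : N a = 1)
    (hb : N b = 1) (hab : N (a - b) = 1) (x : Plane) : ∃ s t : ℝ, s • a + t • b = x := by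
  have hli : LinearIndependent ℝ ![a, b] := by
    rw [LinearIndependent.pair_iff]
    intro s t h
    have h1 : s • a = (-t) • b := by rw [neg_smul]; exact eq_neg_of_add_eq_zero_left h
    have h2 : |s| = |t| := by
      have := congrArg N h1
      simpa [map_smul_eq_mul, ha, hb] using this
    by_contra hst
    have hs : s ≠ 0 := by
      rintro rfl
      apply hst
      simpa using h2.symm
    rcases abs_eq_abs.1 h2 with h3 | h3
    · subst h3
      have : a = -b := by
        have h4 : s • a = s • (-b) := by rw [h1]; module
        exact smul_right_injective _ hs h4
      rw [this, Seminorm.map_neg_sub_self, hb] at hab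
      norm_num at hab
    · have : a = b := smul_right_injective _ hs (by simpa [h3] using h1)
      simp [this] at hab
  have := hli.span_eq_top_of_card_eq_finrank (by simp)
  have hx : x ∈ Submodule.span ℝ (Set.range ![a, b]) := this ▸ Submodule.mem_top
  rw [Matrix.range_cons, Matrix.range_cons, Matrix.range_empty, Set.union_empty,
    Set.singleton_union, Submodule.mem_span_pair] at hx
  exact hx

/-- The points of the unit ball far from the unit vector `a` lie in four consecutive sectors of an
affine regular hexagon with vertex `a` inscribed in the unit ball. -/
theorem exists_hexagon (hN : ∀ x, N x = 0 → x = 0) (hc : Continuous N) {a : Plane} (ha : N a = 1) :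
    ∃ w : Fin 5 → Plane, (∀ k, N (w k) = 1) ∧ (∀ k : Fin 4, N (w k.castSucc - w k.succ) ≤ 1) ∧
      w 2 = -a ∧ w 1 = w 0 + w 2 ∧ w 3 = w 4 + w 2 ∧ ∀ x, N x ≤ 1 → 1 < N (x - a) →
        ∃ k : Fin 4, InSector (w k.castSucc) (w k.succ) x := by
  obtain ⟨b, hb, hab⟩ := Seminorm.exists_unit_eq hN hc (F := fun x => N (x - a)) (by fun_prop) ha
    (r := 1) (by simp) (by rw [Seminorm.map_neg_sub_self, ha]; norm_num)
  have hab' : N (a - b) = 1 := by rwa [map_sub_rev]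
  refine ⟨![b, b - a, -a, -b, a - b], ?_, ?_, rfl, ?_, ?_, ?_⟩
  · intro k
    fin_cases k <;> simp [ha, hb, hab, hab']
  · intro k
    fin_cases k
    · simp [ha]
    · simp [hb]
    · have e : -a - -b = b - a := by abel
      simp [e, hab]
    · have e : -b - (a - b) = -a := by abel
      simp [e, ha]
  · simp [sub_eq_add_neg]
  · change -b = a - b + -a
    abel
  · intro x hx hxa
    obtain ⟨s, t, rfl⟩ := exists_smul_add_smul_of_unit ha hb hab' x
    -- The signs of `s`, `t` and `s + t` select one of the six sectors; the two sectors at `a`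
    -- contain only points of the ball within distance one of `a`.
    rcases le_total 0 s with hs | hs <;> rcases le_total 0 t with ht | ht
    · exact absurd (Seminorm.map_sub_le_one_of_inSector ha hb hab'.le ⟨s, t, hs, ht, rfl⟩
        (InSector.left _ _) hx ha.le) (not_le.2 hxa)
    · rcases le_total 0 (s + t) with h | h
      · have e : a - (a - b) = b := by abel
        refine absurd (Seminorm.map_sub_le_one_of_inSector (b := a - b) ha hab' (by rw [e, hb])
          ⟨s + t, -t, h, by linarith, by module⟩
          (InSector.left _ _) hx ha.le) (not_le.2 hxa)
      · exact ⟨3, -(s + t), s, by linarith, hs, by simp; module⟩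
    · rcases le_total 0 (s + t) with h | h
      · exact ⟨0, s + t, -s, h, by linarith, by simp; module⟩
      · exact ⟨1, t, -(s + t), ht, by linarith, by simp; module⟩
    · exact ⟨2, -s, -t, by linarith, by linarith, by simp⟩

/-- The part of the unit ball in one sector has diameter at most one, so it holds at most one of the
separated points. -/
theorem exists_injective_sector (hN : ∀ x, N x = 0 → x = 0) (hc : Continuous N) {ι : Type*}
    {f : ι → Plane} (hf : ∀ i, N (f i) ≤ 1) (hd : ∀ i j, i ≠ j → 1 < N (f i - f j)) {i : ι}
    (hi : N (f i) = 1) :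
    ∃ w : Fin 5 → Plane, (∀ k, N (w k) = 1) ∧ (∀ k : Fin 4, N (w k.castSucc - w k.succ) ≤ 1) ∧
      w 2 = -f i ∧ w 1 = w 0 + w 2 ∧ w 3 = w 4 + w 2 ∧ ∃ g : {j // j ≠ i} → Fin 4, Function.Injective g ∧
        ∀ j, InSector (w (g j).castSucc) (w (g j).succ) (f j) := by
  obtain ⟨w, hw, hw', h2, e1, e3, hx⟩ := exists_hexagon hN hc hi
  choose g hg using fun j : {j // j ≠ i} => hx (f j) (hf j) (hd j i j.2)
  refine ⟨w, hw, hw', h2, e1, e3, g, fun j k hjk => ?_, hg⟩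
  by_contra hne
  have hk := hg k
  rw [← hjk] at hk
  have := Seminorm.map_sub_le_one_of_inSector (hw _) (hw _) (hw' _) (hg j) hk (hf j) (hf k)
  have := hd j k (fun h => hne (Subtype.ext h))
  linarith

theorem card_le_five_of_separated (hN : ∀ x, N x = 0 → x = 0) (hc : Continuous N) {ι : Type*}
    [Fintype ι] {f : ι → Plane} (hf : ∀ i, N (f i) = 1)
    (hd : ∀ i j, i ≠ j → 1 < N (f i - f j)) : Fintype.card ι ≤ 5 := by
  classical
  rcases isEmpty_or_nonempty ι with h | ⟨⟨i⟩⟩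
  · simp
  obtain ⟨w, -, -, -, -, -, g, hg, -⟩ := exists_injective_sector hN hc (fun i => (hf i).le) hd (hf i)
  have := Fintype.card_le_of_injective g hg
  rw [Fintype.card_subtype_compl, Fintype.card_subtype_eq, Fintype.card_fin] at this
  omega

/-- In a separated pentagon on the unit circle, the antipode of each vertex is adjacent to exactly
two other vertices. -/
theorem exists_antipodal_neighbors (hN : ∀ x, N x = 0 → x = 0) (hc : Continuous N)
    {f : Fin 5 → Plane} (hf : ∀ i, N (f i) = 1)
    (hd : ∀ i j, i ≠ j → 1 < N (f i - f j)) (i : Fin 5) :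
    ∃ x y, x ≠ y ∧ ∀ j, N (f i + f j) ≤ 1 ↔ j = x ∨ j = y := by
  obtain ⟨w, hw, hw', h2, e1, e3, g, hg, hs⟩ := exists_injective_sector hN hc (fun i => (hf i).le) hd (hf i)
  have hbij : Function.Bijective g := by
    rw [Fintype.bijective_iff_injective_and_card]
    refine ⟨hg, ?_⟩
    rw [Fintype.card_subtype_compl, Fintype.card_subtype_eq, Fintype.card_fin, Fintype.card_fin]
  obtain ⟨j0, h0⟩ := hbij.2 0
  obtain ⟨j1, h1⟩ := hbij.2 1
  obtain ⟨j2, h22⟩ := hbij.2 2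
  obtain ⟨j3, h3⟩ := hbij.2 3
  have s0 := hs j0
  have s1 := hs j1
  have s2 := hs j2
  have s3 := hs j3
  rw [h0] at s0
  rw [h1] at s1
  rw [h22] at s2
  rw [h3] at s3
  have n1 := hw' 1
  have n2 := hw' 2
  change N (w 1 - w 2) ≤ 1 at n1
  change N (w 2 - w 3) ≤ 1 at n2
  change InSector (w 0) (w 1) _ at s0
  change InSector (w 1) (w 2) _ at s1
  change InSector (w 2) (w 3) _ at s2
  change InSector (w 3) (w 4) _ at s3
  have ea : ∀ j, f i + f j = f j - -f i := fun j => by abel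
  have l1 : N (f i + f j1) ≤ 1 := by
    rw [ea, ← h2]
    exact Seminorm.map_sub_le_one_of_inSector (hw 1) (hw 2) n1 s1 (InSector.right _ _)
      (hf _).le (hw 2).le
  have l2 : N (f i + f j2) ≤ 1 := by
    rw [ea, ← h2]
    exact Seminorm.map_sub_le_one_of_inSector (hw 2) (hw 3) n2 s2 (InSector.left _ _)
      (hf _).le (hw 2).le
  have hne : ∀ j, f j ≠ 0 := fun j h => by simpa [h] using hf j
  have hjne : ∀ {j k : {j // j ≠ i}}, g j ≠ g k → j.1 ≠ k.1 :=
    fun h h' => h (congrArg g (Subtype.ext h'))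
  -- If `f x` were within one of `-f i`, their sector would have diameter at most one in the ball,
  -- yet it also contains `f y`.
  have far : ∀ {x y : {j // j ≠ i}} {u}, N u = 1 → g x ≠ g y → u = -f i →
      InSector (f x) u (f y) → ¬ N (f i + f x) ≤ 1 := by
    intro x y u hu hxy hui hsec hle
    rw [ea, ← hui] at hle
    have := Seminorm.map_sub_le_one_of_inSector (hf x) hu hle (InSector.left _ _) hsec
      (hf x).le (hf y).le
    exact absurd (hd x y (hjne hxy)) (not_lt.2 this)
  rw [e1] at s0 s1
  rw [e3] at s2 s3
  have l0 := far (hw 2) (by rw [h0, h1]; decide) h2 (InSector.of_adjacent (hne _) s0 s1)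
  have l3 := far (hw 2) (by rw [h3, h22]; decide) h2 (InSector.of_adjacent (hne _) s3.symm s2.symm)
  refine ⟨j1, j2, hjne (by rw [h1, h22]; decide), fun j => ⟨fun hj => ?_, ?_⟩⟩
  · have hji : j ≠ i := by
      rintro rfl
      rw [← two_smul ℝ, N.map_two_smul, hf] at hj
      norm_num at hj
    have key : ∀ k, g ⟨j, hji⟩ = g k → j = k.1 := fun k hk => congrArg Subtype.val (hg hk)
    generalize hm : g ⟨j, hji⟩ = m at key
    fin_cases m
    · exact absurd (key j0 h0.symm ▸ hj) l0
    · exact Or.inl (key j1 h1.symm)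
    · exact Or.inr (key j2 h22.symm)
    · exact absurd (key j3 h3.symm ▸ hj) l3
  · rintro (rfl | rfl)
    · exact l1
    · exact l2

end PlaneNorm

/-! ### Long induced paths on the unit circle. -/

section Paths

/-- A symmetric relation on five points in which every point has exactly two partners is a
cycle. -/
theorem exists_cycle_of_two_regular {h : Fin 5 → Fin 5 → Prop} (hs : ∀ i j, h i j → h j i)
    (hi : ∀ i, ¬ h i i) (hr : ∀ i, ∃ x y, x ≠ y ∧ ∀ j, h i j ↔ j = x ∨ j = y) :
    ∃ c : Fin 5 → Fin 5, Function.Injective c ∧ ∀ i j, h (c i) (c j) ↔ j = i + 1 ∨ i = j + 1 := by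
  choose p q hpq hh using hr
  have other : ∀ i x, h i x → ∃ z, z ≠ x ∧ ∀ j, h i j ↔ j = x ∨ j = z := by
    intro i x hx
    rcases (hh i x).1 hx with rfl | rfl
    · exact ⟨q i, (hpq i).symm, hh i⟩
    · exact ⟨p i, hpq i, fun j => by rw [hh i, or_comm]⟩
  have fifth : ∀ a b c d : Fin 5, ∃ e, e ≠ a ∧ e ≠ b ∧ e ≠ c ∧ e ≠ d := by decide
  have all : ∀ a b c d e : Fin 5, a ≠ b → a ≠ c → a ≠ d → a ≠ e → b ≠ c → b ≠ d → b ≠ e → c ≠ d →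
      c ≠ e → d ≠ e → ∀ f, f = a ∨ f = b ∨ f = c ∨ f = d ∨ f = e := by decide
  obtain ⟨x, y, hxy, h0⟩ : ∃ x y, x ≠ y ∧ ∀ j, h 0 j ↔ j = x ∨ j = y := ⟨_, _, hpq 0, hh 0⟩
  have hx0 : x ≠ 0 := fun e => hi 0 ((h0 0).2 (Or.inl e.symm))
  have hy0 : y ≠ 0 := fun e => hi 0 ((h0 0).2 (Or.inr e.symm))
  obtain ⟨z, hz0, hx⟩ := other x 0 (hs _ _ ((h0 x).2 (Or.inl rfl)))
  obtain ⟨w, hw0, hy⟩ := other y 0 (hs _ _ ((h0 y).2 (Or.inr rfl)))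
  have hzx : z ≠ x := fun e => hi x ((hx x).2 (Or.inr e.symm))
  have hwy : w ≠ y := fun e => hi y ((hy y).2 (Or.inr e.symm))
  -- A triangle would leave two points with only each other as possible partners.
  have hzy : z ≠ y := by
    rintro rfl
    have hwx : x = w := ((hy x).1 (hs _ _ ((hx _).2 (Or.inr rfl)))).resolve_left hx0
    subst hwx
    obtain ⟨d, hd0, hdx, hdz, -⟩ := fifth 0 x z z
    obtain ⟨e, he0, hex, hez, hed⟩ := fifth 0 x z d
    have key : ∀ n, h d n → n = e := by
      intro n hn
      have hn' := hs _ _ hn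
      have := hi d
      rcases all 0 x z d e hx0.symm hy0.symm hd0.symm he0.symm hxy hdx.symm hex.symm hdz.symm
        hez.symm hed.symm n with rfl | rfl | rfl | rfl | rfl <;> grind
    exact hpq d ((key _ ((hh d _).2 (Or.inl rfl))).trans (key _ ((hh d _).2 (Or.inr rfl))).symm)
  have hwx : w ≠ x := by
    rintro rfl
    have := (hx y).1 (hs _ _ ((hy w).2 (Or.inr rfl)))
    grind
  -- A 4-cycle would leave the fifth point without a partner.
  have hwz : w ≠ z := by
    rintro rfl
    obtain ⟨e, he0, hex, hey, hew⟩ := fifth 0 x y w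
    have hn := (hh e (p e)).2 (Or.inl rfl)
    have hn' := hs _ _ hn
    have hw := (other w x (hs _ _ ((hx w).2 (Or.inr rfl))))
    have hwy' := hs _ _ ((hy w).2 (Or.inr rfl))
    have := hi e
    generalize p e = n at hn hn'
    rcases all 0 x y w e hx0.symm hy0.symm hw0.symm he0.symm hxy hwx.symm hex.symm hwy.symm
      hey.symm hew.symm n with rfl | rfl | rfl | rfl | rfl <;> grind
  have hz : ∀ j, h z j ↔ j = x ∨ j = w := by
    obtain ⟨v, hvx, hz⟩ := other z x (hs _ _ ((hx z).2 (Or.inr rfl)))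
    have hv := (hz v).2 (Or.inr rfl)
    have hv' := hs _ _ hv
    have := hi z
    rcases all 0 x y z w hx0.symm hy0.symm hz0.symm hw0.symm hxy hzx.symm hwx.symm hzy.symm
      hwy.symm hwz.symm v with rfl | rfl | rfl | rfl | rfl <;> grind
  have hw : ∀ j, h w j ↔ j = y ∨ j = z := by
    obtain ⟨v, hvy, hw⟩ := other w y (hs _ _ ((hy w).2 (Or.inr rfl)))
    have := (hw z).1 (hs _ _ ((hz w).2 (Or.inr rfl)))
    grind
  refine ⟨![0, x, z, w, y], ?_, ?_⟩
  · intro i j hij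
    fin_cases i <;> fin_cases j <;> first | rfl | (exfalso; simp at hij; grind)
  · intro i j
    fin_cases i <;> fin_cases j <;> simp [h0, hx, hy, hz, hw] <;> grind

variable {N : Seminorm ℝ Plane}

theorem exists_isosceles_pair (hN : ∀ x, N x = 0 → x = 0) (hc : Continuous N) :
    ∃ u v c, N u = 1 ∧ N v = 1 ∧ N (u + v) = c ∧ N (u - v) = c := by
  obtain ⟨x, hx⟩ := exists_ne (0 : Plane)
  have hx0 : N x ≠ 0 := fun h => hx (hN x h)
  have hu : N ((N x)⁻¹ • x) = 1 := by
    rw [map_smul_eq_mul, Real.norm_of_nonneg (inv_nonneg.2 (apply_nonneg N x)),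
      inv_mul_cancel₀ hx0]
  set u := (N x)⁻¹ • x
  obtain ⟨v, hv, h⟩ := Seminorm.exists_unit_eq hN hc (F := fun y => N (u - y) - N (u + y))
    (by fun_prop) hu (r := 0) (by simp) (by simp)
  exact ⟨u, v, _, hu, hv, rfl, by linarith⟩

/-- Here `N` is the maximum norm in the coordinates of `u` and `v`; the new pair is `(1, 1/2)`,
`(-1/2, 1)`. The triangle inequality gives upper bounds, and writing `u` and `v` as combinations
turns them into matching lower bounds. -/
theorem exists_isosceles_pair_of_eq_one {u v : Plane} (hu : N u = 1) (hv : N v = 1)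
    (h1 : N (u + v) = 1) (h2 : N (u - v) = 1) :
    ∃ u' v', N u' = 1 ∧ N v' = 1 ∧ N (u' + v') = 3 / 2 ∧ N (u' - v') = 3 / 2 := by
  have comb : ∀ (α β : ℝ) (x y z : Plane), 0 ≤ α → 0 ≤ β → z = α • x + β • y →
      N z ≤ α * N x + β * N y := by
    rintro α β x y z hα hβ rfl
    exact N.map_smul_add_smul_le hα hβ x y
  have h3 : N (v - u) = 1 := by rwa [map_sub_rev]
  have a1 := comb (1/2) (1/2) u (u + v) (u + (1/2 : ℝ) • v) (by simp) (by simp) (by module)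
  have a2 := comb (1/2) (1/2) u (u - v) (u - (1/2 : ℝ) • v) (by simp) (by simp) (by module)
  have a3 := comb (1/2) (1/2) _ _ u (by simp) (by simp)
    (show u = _ • (u + (1/2 : ℝ) • v) + _ • (u - (1/2 : ℝ) • v) by module)
  have b1 := comb (1/2) (1/2) v (u + v) (v + (1/2 : ℝ) • u) (by simp) (by simp) (by module)
  have b2 := comb (1/2) (1/2) v (v - u) (v - (1/2 : ℝ) • u) (by simp) (by simp) (by module)
  have b3 := comb (1/2) (1/2) _ _ v (by simp) (by simp)
    (show v = _ • (v + (1/2 : ℝ) • u) + _ • (v - (1/2 : ℝ) • u) by module)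
  have c1 := comb 1 (1/2) v (u + v) (u + (1/2 : ℝ) • v + (v - (1/2 : ℝ) • u)) (by simp) (by simp)
    (by module)
  have c2 := comb 1 (1/2) v (v - u) ((3/2 : ℝ) • v - (1/2 : ℝ) • u) (by simp) (by simp) (by module)
  have c3 := comb (1/3) (1/3) _ _ v (by simp) (by simp)
    (show v = _ • (u + (1/2 : ℝ) • v + (v - (1/2 : ℝ) • u)) +
      _ • ((3/2 : ℝ) • v - (1/2 : ℝ) • u) by module)
  have d1 := comb 1 (1/2) u (u - v) (u + (1/2 : ℝ) • v - (v - (1/2 : ℝ) • u)) (by simp) (by simp)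
    (by module)
  have d2 := comb 1 (1/2) u (u + v) ((3/2 : ℝ) • u + (1/2 : ℝ) • v) (by simp) (by simp) (by module)
  have d3 := comb (1/3) (1/3) _ _ u (by simp) (by simp)
    (show u = _ • (u + (1/2 : ℝ) • v - (v - (1/2 : ℝ) • u)) +
      _ • ((3/2 : ℝ) • u + (1/2 : ℝ) • v) by module)
  refine ⟨u + (1/2 : ℝ) • v, v - (1/2 : ℝ) • u, ?_, ?_, ?_, ?_⟩ <;> linarith

/-- Always `1 ≤ c ≤ 2`. If `c = 1` the pair is replaced; if `c = 2`, half the sum and half the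
difference reduce to that case. -/
theorem exists_isosceles_pair_lt (hN : ∀ x, N x = 0 → x = 0) (hc : Continuous N) :
    ∃ u v c, N u = 1 ∧ N v = 1 ∧ N (u + v) = c ∧ N (u - v) = c ∧ 1 < c ∧ c < 2 := by
  obtain ⟨u, v, c, hu, hv, h1, h2⟩ := exists_isosceles_pair hN hc
  have half : ∀ x, N ((1/2 : ℝ) • x) = 1/2 * N x := fun x => by
    rw [map_smul_eq_mul, Real.norm_of_nonneg (by norm_num)]
  have hc1 : 1 ≤ c := by
    have := N.map_smul_add_smul_le (α := 1/2) (β := 1/2) (by norm_num) (by norm_num) (u + v) (u - v)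
    rw [show (1/2 : ℝ) • (u + v) + (1/2 : ℝ) • (u - v) = u by module] at this
    linarith
  have hc2 : c ≤ 2 := by
    have := map_add_le_add N u v
    linarith
  rcases hc1.eq_or_lt with h | h
  · obtain ⟨u', v', a, b, d, e⟩ := exists_isosceles_pair_of_eq_one hu hv (h1.trans h.symm)
      (h2.trans h.symm)
    exact ⟨u', v', _, a, b, d, e, by norm_num, by norm_num⟩
  rcases hc2.eq_or_lt with h' | h'
  · obtain ⟨u', v', a, b, d, e⟩ := exists_isosceles_pair_of_eq_one (N := N)
      (u := (1/2 : ℝ) • (u + v)) (v := (1/2 : ℝ) • (u - v)) (by rw [half]; linarith)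
      (by rw [half]; linarith)
      (by rw [show (1/2 : ℝ) • (u + v) + (1/2 : ℝ) • (u - v) = u by module, hu])
      (by rw [show (1/2 : ℝ) • (u + v) - (1/2 : ℝ) • (u - v) = v by module, hv])
    exact ⟨u', v', _, a, b, d, e, by norm_num, by norm_num⟩
  exact ⟨u, v, c, hu, hv, h1, h2, h, h'⟩

theorem Seminorm.map_sub_smul_sub_le_one {u v : Plane} (hu : N u = 1) (hv : N v = 1) {d : ℝ}
    (hd : 0 ≤ d) (hd1 : d ≤ 1) : N (u - d • (u - v)) ≤ 1 := by
  have := N.map_smul_add_smul_le (sub_nonneg.2 hd1) hd u v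
  rw [show (1 - d) • u + d • v = u - d • (u - v) by module] at this
  nlinarith

theorem Seminorm.one_lt_map_add_smul_sub {u v : Plane} (hu : N u = 1) (huv : N (u + v) < 2) {d : ℝ}
    (hd : 0 < d) : 1 < N (u + d • (u - v)) := by
  have h := N.map_smul_add_smul_le zero_le_one hd.le (u + d • (u - v)) (u + v)
  rw [show (1 : ℝ) • (u + d • (u - v)) + d • (u + v) = (1 + 2 * d) • u by module,
    map_smul_eq_mul, hu, Real.norm_of_nonneg (by positivity)] at h
  nlinarith

/-- A sequence of unit vectors, two of which are at distance at most one iff they are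
consecutive. -/
def IsUnitPath (N : Seminorm ℝ Plane) {n : ℕ} (P : Fin n → Plane) : Prop :=
  (∀ i, N (P i) = 1) ∧ ∀ i j, i < j → (N (P i - P j) ≤ 1 ↔ (j : ℕ) = i + 1)

/-- The points are seven vertices of the octagon `±u`, `±v`, `±d • (u + v)`, `±d • (u - v)` with `d
= 1 / c`. The bound `1 < c` separates `u` from `±v`, and `c < 2` gives `1 < 2 * d`, which separates
`d • (u + v)` from `d • (v - u)`. -/
theorem exists_unitPath_seven (hN : ∀ x, N x = 0 → x = 0) (hc : Continuous N) :
    ∃ P : Fin 7 → Plane, IsUnitPath N P := by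
  obtain ⟨u, v, c, hu, hv, h1, h2, hc1, hc2⟩ := exists_isosceles_pair_lt hN hc
  have hc0 : 0 < c := by linarith
  obtain ⟨d, hd0, hdc⟩ : ∃ d : ℝ, 0 < d ∧ d * c = 1 := ⟨c⁻¹, by positivity, inv_mul_cancel₀ hc0.ne'⟩
  have hd1 : d ≤ 1 := by nlinarith
  have hd2 : 1 < 2 * d := by nlinarith
  have hnv : N (-v) = 1 := by rw [map_neg_eq_map, hv]
  have hnu : N (-u) = 1 := by rw [map_neg_eq_map, hu]
  have near : ∀ {X Y : Plane} {p : Prop}, N X ≤ 1 → p → (Y = X ∨ Y = -X) → (N Y ≤ 1 ↔ p) := by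
    rintro X Y p hX hp (rfl | rfl)
    · simp [hX, hp]
    · simp [hX, hp]
  have far : ∀ {X Y : Plane} {p : Prop}, 1 < N X → ¬ p → (Y = X ∨ Y = -X) → (N Y ≤ 1 ↔ p) := by
    rintro X Y p hX hp (rfl | rfl)
    · simp [hX, hp]
    · simp [hX, hp]
  have a1 := Seminorm.map_sub_smul_sub_le_one hu hnv hd0.le hd1
  have a2 := Seminorm.map_sub_smul_sub_le_one hv hnu hd0.le hd1
  have a3 := Seminorm.map_sub_smul_sub_le_one hv hu hd0.le hd1
  have a4 := Seminorm.map_sub_smul_sub_le_one hu hv hd0.le hd1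
  have b1 := Seminorm.one_lt_map_add_smul_sub (v := -v) hu (by rw [← sub_eq_add_neg]; linarith) hd0
  have b2 := Seminorm.one_lt_map_add_smul_sub (v := -u) hv
    (by rw [← sub_eq_add_neg, map_sub_rev]; linarith) hd0
  have b3 := Seminorm.one_lt_map_add_smul_sub (v := u) hv (by rw [add_comm]; linarith) hd0
  have b4 := Seminorm.one_lt_map_add_smul_sub (v := v) hu (by linarith) hd0
  have smul : ∀ (r : ℝ) (x : Plane), 0 ≤ r → N (r • x) = r * N x := fun r x hr => by
    rw [map_smul_eq_mul, Real.norm_of_nonneg hr]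
  have c1 : 1 < N (u + v) := by linarith
  have c2 : 1 < N (u - v) := by linarith
  have c3 : 1 < N ((2 : ℝ) • u) := by rw [smul _ _ zero_le_two]; linarith
  have c4 : 1 < N ((2 : ℝ) • v) := by rw [smul _ _ zero_le_two]; linarith
  have c5 : 1 < N ((2 * d) • u) := by rw [smul _ _ (by positivity)]; rwa [hu, mul_one]
  have c6 : 1 < N ((2 * d) • v) := by rw [smul _ _ (by positivity)]; rwa [hv, mul_one]
  have c7 : 1 < N ((2 * d) • (u + v)) := by rw [smul _ _ (by positivity), h1]; linarith
  refine ⟨![u, d • (u + v), v, d • (v - u), -u, -(d • (u + v)), -v], ?_, ?_⟩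
  · have e1 : N (d • (u + v)) = 1 := by rw [smul _ _ hd0.le, h1, hdc]
    have e2 : N (d • (v - u)) = 1 := by rw [smul _ _ hd0.le, map_sub_rev, h2, hdc]
    intro i
    fin_cases i
    exacts [hu, e1, hv, e2, hnu, (map_neg_eq_map N _).trans e1, hnv]
  · intro i j hij
    fin_cases i <;> fin_cases j <;> first
      | exact absurd hij (by decide)
      | (dsimp only [Fin.reduceFinMk, Matrix.cons_val]
         first
         | exact near a1 (by decide) (by first | (left; module) | (right; module))
         | exact near a2 (by decide) (by first | (left; module) | (right; module))
         | exact near a3 (by decide) (by first | (left; module) | (right; module))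
         | exact near a4 (by decide) (by left; module)
         | exact far b1 (by decide) (by first | (left; module) | (right; module))
         | exact far b2 (by decide) (by first | (left; module) | (right; module))
         | exact far b3 (by decide) (by first | (left; module) | (right; module))
         | exact far b4 (by decide) (by first | (left; module) | (right; module))
         | exact far c1 (by decide) (by first | (left; module) | (right; module))
         | exact far c2 (by decide) (by first | (left; module) | (right; module))
         | exact far c3 (by decide) (by first | (left; module) | (right; module))
         | exact far c4 (by decide) (by first | (left; module) | (right; module))
         | exact far c5 (by decide) (by first | (left; module) | (right; module))
         | exact far c6 (by decide) (by first | (left; module) | (right; module))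
         | exact far c7 (by decide) (by left; module))

/-- Closeness of `f i` to `-f j` is a 5-cycle. As five is odd, following it with alternating signs
closes up only after all ten points `±f i`; the omitted one is `-f (c 4)`. -/
theorem exists_unitPath_nine (hN : ∀ x, N x = 0 → x = 0) (hc : Continuous N) {f : Fin 5 → Plane}
    (hf : ∀ i, N (f i) = 1) (hd : ∀ i j, i ≠ j → 1 < N (f i - f j)) :
    ∃ P : Fin 9 → Plane, IsUnitPath N P := by
  obtain ⟨c, hc, hcc⟩ := exists_cycle_of_two_regular (h := fun i j => N (f i + f j) ≤ 1)
    (fun i j h => by rwa [add_comm]) (fun i h => by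
      rw [← two_smul ℝ, N.map_two_smul, hf] at h
      norm_num at h) (exists_antipodal_neighbors hN hc hf hd)
  have h1 : ∀ i j, N (f (c i) - f (c j)) ≤ 1 ↔ i = j := fun i j => by
    refine ⟨fun h => ?_, fun h => by simp [h]⟩
    by_contra hij
    exact absurd (hd _ _ (hc.ne hij)) (not_lt.2 h)
  have m1 : ∀ i j, N (f (c i) - -f (c j)) ≤ 1 ↔ j = i + 1 ∨ i = j + 1 := fun i j => by
    rw [sub_neg_eq_add, hcc]
  have m2 : ∀ i j, N (-f (c i) - f (c j)) ≤ 1 ↔ j = i + 1 ∨ i = j + 1 := fun i j => by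
    rw [← hcc, ← map_neg_eq_map, neg_sub, sub_neg_eq_add, add_comm]
  have m3 : ∀ i j, N (-f (c i) - -f (c j)) ≤ 1 ↔ i = j := fun i j => by
    rw [← h1, ← map_neg_eq_map, neg_sub, neg_sub_neg]
  refine ⟨![f (c 0), -f (c 1), f (c 2), -f (c 3), f (c 4), -f (c 0), f (c 1), -f (c 2), f (c 3)],
    ?_, ?_⟩
  · intro i
    fin_cases i <;> simp [hf]
  · intro i j hij
    fin_cases i <;> fin_cases j <;> first
      | exact absurd hij (by decide)
      | (dsimp only [Fin.reduceFinMk, Matrix.cons_val]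
         first
         | (rw [m3]; decide)
         | (rw [m1]; decide)
         | (rw [m2]; decide)
         | (rw [h1]; decide))

end Paths

/-! ### Forcing an online algorithm along an induced path. -/

section Online

variable {V : Type*} {G : SimpleGraph V}

theorem isOnlineInput_nil : IsOnlineInput G [] := by
  refine ⟨List.nodup_nil, fun J hJ => ?_⟩
  rw [List.prefix_nil.1 hJ]
  rintro ⟨x, hx⟩
  simp at hx

theorem IsOnlineInput.append_singleton {I : List V} {w : V} (hI : IsOnlineInput G I) (hw : w ∉ I)
    (h : I = [] ∨ ∃ u ∈ I, G.Adj u w) : IsOnlineInput G (I ++ [w]) := by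
  refine ⟨by simp [List.nodup_append, hI.1]; rintro a ha rfl; exact hw ha, fun J hJ => ?_⟩
  rcases List.prefix_concat_iff.1 hJ with rfl | hJ
  · rcases h with rfl | ⟨u, hu, huw⟩
    · rintro ⟨x, hx⟩ ⟨y, hy⟩
      simp at hx hy
      subst hx hy
      rfl
    · have e : {v | v ∈ I ++ [w]} = {v | v ∈ I} ∪ {w} := by ext; simp [or_comm]
      rw [e]
      refine (SimpleGraph.connected_induce_union (hI.2 I List.prefix_rfl) ?_ hu
        (mem_singleton w) huw).preconnected
      rintro ⟨x, rfl⟩ ⟨y, rfl⟩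
      rfl
  · exact hI.2 J hJ

/-- The first `k` terms of a sequence. -/
def firstTerms (v : ℕ → V) (k : ℕ) : List V := (List.range k).map v

theorem firstTerms_succ (v : ℕ → V) (k : ℕ) : firstTerms v (k + 1) = firstTerms v k ++ [v k] := by
  simp [firstTerms, List.range_succ]

theorem mem_firstTerms {v : ℕ → V} {k : ℕ} {x : V} : x ∈ firstTerms v k ↔ ∃ i < k, v i = x := by
  simp [firstTerms]

/-- `v` traces an induced path on its first `n` terms. -/
structure IsInducedPath (G : SimpleGraph V) (v : ℕ → V) (n : ℕ) : Prop where
  ne : ∀ i j, i < j → j < n → v i ≠ v j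
  adj : ∀ i j, i < j → j < n → (G.Adj (v i) (v j) ↔ j = i + 1)

variable {v : ℕ → V} {n : ℕ}

theorem IsInducedPath.isOnlineInput (hv : IsInducedPath G v n) {k : ℕ} (hk : k ≤ n) :
    IsOnlineInput G (firstTerms v k) := by
  induction k with
  | zero => exact isOnlineInput_nil
  | succ k ih =>
    rw [firstTerms_succ]
    refine (ih (by omega)).append_singleton ?_ ?_
    · rw [mem_firstTerms]
      rintro ⟨i, hi, h⟩
      exact hv.ne i k hi (by omega) h
    · rcases k with _ | k
      · exact Or.inl rfl
      · exact Or.inr ⟨v k, mem_firstTerms.2 ⟨k, by omega, rfl⟩, (hv.adj k (k + 1) (by omega)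
          (by omega)).2 rfl⟩

/-- Each new vertex is a leaf attached to its predecessor. The predecessor must be accepted, either
to dominate the leaf or, if the leaf is accepted, to connect it to `v 0`, which has been held since
the first arrival. -/
theorem IsInducedPath.mem_sol (hv : IsInducedPath G v n) (A : OnlineCDSAlgorithm G) {k : ℕ}
    (hk : k + 1 < n) : ∀ i ≤ k, v i ∈ A.sol (firstTerms v (k + 2)) := by
  have zero_mem : v 0 ∈ A.sol (firstTerms v 1) := by
    obtain ⟨hsub, hdom, -⟩ := A.feasible _ (hv.isOnlineInput (k := 1) (by omega))
    rcases hdom (v 0) (mem_firstTerms.2 ⟨0, by omega, rfl⟩) with h | ⟨u, hu, huv⟩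
    · exact h
    · obtain ⟨i, hi, rfl⟩ := mem_firstTerms.1 (hsub hu)
      obtain rfl : i = 0 := by omega
      exact absurd huv (G.irrefl)
  have mono : ∀ m < n, A.sol (firstTerms v m) ⊆ A.sol (firstTerms v (m + 1)) := by
    intro m hm
    have := hv.isOnlineInput (k := m + 1) (by omega)
    rw [firstTerms_succ] at this ⊢
    exact A.irrevocable _ _ this
  have zero_mem' : ∀ m < n, v 0 ∈ A.sol (firstTerms v (m + 1)) := by
    intro m hm
    induction m with
    | zero => exact zero_mem
    | succ m ih => exact mono _ hm (ih (by omega))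
  have last_mem : ∀ m, m + 1 < n → v m ∈ A.sol (firstTerms v (m + 2)) := by
    intro m hm
    obtain ⟨hsub, hdom, hconn⟩ := A.feasible _ (hv.isOnlineInput (k := m + 2) (by omega))
    have key : ∀ u ∈ A.sol (firstTerms v (m + 2)), G.Adj u (v (m + 1)) →
        v m ∈ A.sol (firstTerms v (m + 2)) := by
      intro u hu huv
      obtain ⟨i, hi, rfl⟩ := mem_firstTerms.1 (hsub hu)
      have hi' : i ≠ m + 1 := by rintro rfl; exact G.irrefl huv
      have := (hv.adj i (m + 1) (by omega) hm).1 huv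
      obtain rfl : i = m := by omega
      exact hu
    rcases hdom (v (m + 1)) (mem_firstTerms.2 ⟨m + 1, by omega, rfl⟩) with h | ⟨u, hu, huv⟩
    · have h0 := zero_mem' (m + 1) hm
      have hne : v 0 ≠ v (m + 1) := hv.ne _ _ (by omega) hm
      have : Nontrivial ((A.sol (firstTerms v (m + 2)) : Finset V) : Set V) :=
        ⟨⟨v 0, h0⟩, ⟨v (m + 1), h⟩, fun e => hne (congrArg Subtype.val e)⟩
      obtain ⟨⟨u, hu⟩, huv⟩ := hconn.exists_adj_of_nontrivial ⟨v (m + 1), h⟩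
      exact key u hu (SimpleGraph.induce_adj.1 huv).symm
    · exact key u hu huv
  induction k with
  | zero =>
    intro i hi
    obtain rfl : i = 0 := by omega
    exact last_mem 0 hk
  | succ k ih =>
    intro i hi
    rcases hi.eq_or_lt with rfl | hi
    · exact last_mem _ hk
    · exact mono _ hk (ih (by omega) i (by omega))

/-- An induced path whose vertices are all adjacent to a late hub is a bad input. -/
theorem IsInducedPath.le_of_isCompetitive (hv : IsInducedPath G v (n + 2)) {u : V}
    (hu : ∀ i < n + 2, G.Adj u (v i)) {A : OnlineCDSAlgorithm G} {c : ℝ} (hA : A.IsCompetitive c) :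
    ((n + 1 : ℕ) : ℝ) ≤ c := by
  classical
  have hI : IsOnlineInput G (firstTerms v (n + 2) ++ [u]) := by
    refine (hv.isOnlineInput le_rfl).append_singleton ?_
      (Or.inr ⟨v 0, mem_firstTerms.2 ⟨0, by omega, rfl⟩, (hu 0 (by omega)).symm⟩)
    rw [mem_firstTerms]
    rintro ⟨i, hi, rfl⟩
    exact G.irrefl (hu i hi)
  have hopt : optCDS G (firstTerms v (n + 2) ++ [u]) ≤ 1 := by
    refine Nat.sInf_le ⟨{u}, ⟨by simp, fun x hx => ?_, ?_⟩, by simp⟩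
    · rcases List.mem_append.1 hx with hx | hx
      · obtain ⟨i, hi, rfl⟩ := mem_firstTerms.1 hx
        exact Or.inr ⟨u, by simp, hu i hi⟩
      · exact Or.inl (by simpa using hx)
    · rintro ⟨x, hx⟩ ⟨y, hy⟩
      simp at hx hy
      subst hx hy
      rfl
  have hcard : n + 1 ≤ (A.sol (firstTerms v (n + 2) ++ [u])).card := by
    have hsub : (Finset.range (n + 1)).image v ⊆ A.sol (firstTerms v (n + 2) ++ [u]) := by
      intro x hx
      obtain ⟨i, hi, rfl⟩ := Finset.mem_image.1 hx
      exact A.irrevocable _ _ hI (hv.mem_sol A (k := n) (by omega) i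
        (by simpa [Nat.lt_succ_iff] using hi))
    have := Finset.card_le_card hsub
    rwa [Finset.card_image_of_injOn, Finset.card_range] at this
    intro i hi j hj hij
    simp at hi hj
    rcases lt_trichotomy i j with h | h | h
    · exact absurd hij (hv.ne _ _ h (by omega))
    · exact h
    · exact absurd hij.symm (hv.ne _ _ h (by omega))
  have h := hA _ hI
  have hcard' : ((n + 1 : ℕ) : ℝ) ≤ (A.sol (firstTerms v (n + 2) ++ [u])).card := by
    exact_mod_cast hcard
  -- The value 0 is impossible: it would force an empty solution.
  rcases Nat.le_one_iff_eq_zero_or_eq_one.1 hopt with h0 | h0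
  · rw [h0] at h
    simp at h
    rw [h] at hcard
    simp at hcard
  · rw [h0] at h
    simp only [Nat.cast_one, mul_one] at h
    exact hcard'.trans h

end Online

/-! ### From translates of a convex object to a norm. -/

section Translates

variable {C : Set Plane} {N : Seminorm ℝ Plane}

/-- The translate of `C` by `v`. -/
def translateBy (C : Set Plane) (v : Plane) : Set Plane := (fun x => v + x) '' C

theorem translate_mem_translates (C : Set Plane) (v : Plane) : translateBy C v ∈ translates C :=
  ⟨v, rfl⟩

open scoped Pointwise in
/-- The norm whose unit ball is the difference body of a convex object detects the intersection of
translates. -/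
theorem IsConvexObject.exists_seminorm (hC : IsConvexObject C) :
    ∃ N : Seminorm ℝ Plane, (∀ x, N x = 0 → x = 0) ∧ Continuous N ∧
      ∀ v w, (translateBy C v ∩ translateBy C w).Nonempty ↔ N (v - w) ≤ 1 := by
  have hconv : Convex ℝ (C - C) := hC.convex.sub hC.convex
  have hcomp : IsCompact (C - C) := by
    rw [sub_eq_add_neg]
    exact hC.compact.add hC.compact.neg
  obtain ⟨p, hp⟩ := hC.interior_nonempty
  have h0 : C - C ∈ nhds (0 : Plane) := by
    refine Filter.mem_of_superset (IsOpen.mem_nhds (isOpen_interior (s := C)).sub_right ?_)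
      (Set.sub_subset_sub interior_subset (Subset.refl C))
    exact ⟨p, hp, p, interior_subset hp, sub_self p⟩
  have hneg : ∀ x ∈ C - C, -x ∈ C - C := by
    rintro _ ⟨x, hx, y, hy, rfl⟩
    exact ⟨y, hy, x, hx, by simp⟩
  have habs : Absorbent ℝ (C - C) := absorbent_nhds_zero h0
  have hbal : Balanced ℝ (C - C) := by
    rintro r hr _ ⟨x, hx, rfl⟩
    rw [Real.norm_eq_abs, abs_le] at hr
    -- `r • x` is the convex combination of `x` and `-x` with weights `(1 + r) / 2` and `(1 - r) /
    -- 2`.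
    have := hconv hx (hneg x hx) (show 0 ≤ (1 + r) / 2 by linarith)
      (show 0 ≤ (1 - r) / 2 by linarith) (by ring)
    convert this using 1
    dsimp only
    module
  refine ⟨gaugeSeminorm hbal hconv habs, fun x hx => ?_, continuous_gauge hconv h0, fun v w => ?_⟩
  · exact (gauge_eq_zero habs
      ((NormedSpace.isVonNBounded_iff ℝ).2 hcomp.isBounded)).1 hx
  · change _ ↔ gauge (C - C) (v - w) ≤ 1
    rw [gauge_le_one_iff_mem_closure hconv h0, hcomp.isClosed.closure_eq]
    constructor
    · rintro ⟨_, ⟨x, hx, rfl⟩, ⟨y, hy, h⟩⟩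
      exact ⟨y, hy, x, hx, by
        dsimp only at h ⊢
        rw [sub_eq_sub_iff_add_eq_add, add_comm y, h, add_comm]⟩
    · rintro ⟨y, hy, x, hx, h⟩
      refine ⟨v + x, ⟨x, hx, rfl⟩, ⟨y, hy, ?_⟩⟩
      dsimp only at h ⊢
      rw [sub_eq_sub_iff_add_eq_add] at h
      rw [add_comm w, h]

/-- If two translates coincide, `C` is invariant under all multiples of `v - w`; these translates
all meet `C`, which bounds the multiples. -/
theorem translate_injective (hN : ∀ x, N x = 0 → x = 0)
    (hCN : ∀ v w, (translateBy C v ∩ translateBy C w).Nonempty ↔ N (v - w) ≤ 1) :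
    Function.Injective (translateBy C) := by
  intro v w hvw
  have hadd : ∀ a b, translateBy C (a + b) = (fun x => a + x) '' translateBy C b := fun a b => by
    simp only [translateBy, image_image, add_assoc]
  have hmul : ∀ n : ℕ, translateBy C ((n : ℝ) • (v - w)) = translateBy C 0 := by
    have h1 : translateBy C (v - w) = translateBy C 0 := by
      rw [show v - w = -w + v by abel, hadd, hvw, ← hadd, neg_add_cancel]
    intro n
    induction n with
    | zero => simp
    | succ n ih =>
      rw [Nat.cast_succ, add_smul, one_smul, add_comm, hadd, ih, ← hadd, add_zero, h1]
  have hne : (translateBy C 0 ∩ translateBy C 0).Nonempty := (hCN 0 0).2 (by simp)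
  have hle : ∀ n : ℕ, n * N (v - w) ≤ 1 := by
    intro n
    have := (hCN ((n : ℝ) • (v - w)) 0).1 (by rwa [hmul])
    rwa [sub_zero, map_smul_eq_mul, Real.norm_of_nonneg n.cast_nonneg] at this
  refine sub_eq_zero.1 (hN _ (le_antisymm ?_ (apply_nonneg N _)))
  by_contra! hpos
  obtain ⟨n, hn⟩ := exists_nat_gt (1 / N (v - w))
  rw [div_lt_iff₀ hpos] at hn
  linarith [hle n]

/-- Recentre at `u` and push radially to the unit sphere. With `2 ≤ n` no vector is zero, as zero is
within one of every other vector in the ball. -/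
theorem HasIndependentKissing.exists_separated (hN : ∀ x, N x = 0 → x = 0)
    (hCN : ∀ v w, (translateBy C v ∩ translateBy C w).Nonempty ↔ N (v - w) ≤ 1) {u : Set Plane}
    (hu : u ∈ translates C) {n : ℕ} (hn : 2 ≤ n) (h : HasIndependentKissing (translates C) u n) :
    ∃ f : Fin n → Plane, (∀ i, N (f i) = 1) ∧ ∀ i j, i ≠ j → 1 < N (f i - f j) := by
  obtain ⟨I, hI, hdis, hint, rfl⟩ := h
  obtain ⟨v, rfl⟩ := hu
  choose t ht using fun σ : I => hI σ σ.2
  let e := I.equivFin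
  let g : Fin I.card → Plane := fun i => t (e.symm i) - v
  have hg1 : ∀ i, N (g i) ≤ 1 := fun i => by
    have := hint _ (e.symm i).2
    rw [ht (e.symm i), inter_comm] at this
    exact (hCN _ _).1 this
  have hg2 : ∀ i j, i ≠ j → 1 < N (g i - g j) := fun i j hij => by
    have hne : (e.symm i : Set Plane) ≠ e.symm j := fun h =>
      hij (e.symm.injective (Subtype.ext h))
    have := hdis _ (e.symm i).2 _ (e.symm j).2 hne
    rw [ht (e.symm i), ht (e.symm j), disjoint_iff_inter_eq_empty, ← not_nonempty_iff_eq_empty] at this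
    rw [show g i - g j = t (e.symm i) - t (e.symm j) by simp [g]]
    exact not_le.1 fun h => this ((hCN _ _).2 h)
  have hg0 : ∀ i, 0 < N (g i) := fun i => by
    refine lt_of_le_of_ne (apply_nonneg N _) fun h => ?_
    have : Nontrivial (Fin I.card) := Fin.nontrivial_iff_two_le.2 hn
    obtain ⟨j, hj⟩ := exists_ne i
    have h1 := hg2 j i hj
    rw [hN _ h.symm, sub_zero] at h1
    linarith [hg1 j]
  refine ⟨fun i => (N (g i))⁻¹ • g i, fun i => ?_, fun i j hij => ?_⟩
  · rw [map_smul_eq_mul, Real.norm_of_nonneg (inv_nonneg.2 (hg0 i).le), inv_mul_cancel₀ (hg0 i).ne']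
  · exact Seminorm.one_lt_map_normalize_sub (hg0 i) (hg0 j) (hg1 i) (hg1 j) (hg2 i j hij)

theorem exists_isIndependentKissingNumber (hN : ∀ x, N x = 0 → x = 0) (hc : Continuous N)
    (hCN : ∀ v w, (translateBy C v ∩ translateBy C w).Nonempty ↔ N (v - w) ≤ 1) :
    ∃ ζ ≤ 5, IsIndependentKissingNumber (translates C) ζ := by
  have hbdd : ∀ n ∈ {n | ∃ u ∈ translates C, HasIndependentKissing (translates C) u n}, n ≤ 5 := by
    rintro n ⟨u, hu, h⟩
    rcases le_or_gt 2 n with hn | hn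
    · obtain ⟨f, hf, hd⟩ := h.exists_separated hN hCN hu hn
      simpa using card_le_five_of_separated hN hc hf hd
    · omega
  have hmem := Nat.sSup_mem (s := {n | ∃ u ∈ translates C, HasIndependentKissing (translates C) u n})
    ⟨0, _, translate_mem_translates C 0, ∅, by simp⟩ ⟨5, hbdd⟩
  exact ⟨_, hbdd _ hmem, hmem, fun n hn => le_csSup ⟨5, hbdd⟩ hn⟩

/-- Coinciding points would be consecutive and share their neighbours, but with at least three
points one of them has a neighbour that the other lacks. -/
theorem IsUnitPath.injective {n : ℕ} {P : Fin (n + 3) → Plane} (hP : IsUnitPath N P) :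
    Function.Injective P := by
  have key : ∀ i j, i < j → P i ≠ P j := by
    intro i j hij h
    have hj : (j : ℕ) = i + 1 := (hP.2 i j hij).1 (by simp [h])
    by_cases hlt : (j : ℕ) + 1 < n + 3
    · have h1 := (hP.2 j ⟨j + 1, hlt⟩ (Fin.lt_def.2 (Nat.lt_succ_self _))).2 rfl
      rw [← h] at h1
      have := (hP.2 i ⟨j + 1, hlt⟩ (Fin.lt_def.2 (by simp; omega))).1 h1
      simp only at this
      omega
    · have hi : (i : ℕ) - 1 < n + 3 := by omega
      have h1 := (hP.2 ⟨i - 1, hi⟩ i (by change (i : ℕ) - 1 < i; omega)).2 (by change (i : ℕ) = i - 1 + 1; omega)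
      rw [h] at h1
      have := (hP.2 ⟨i - 1, hi⟩ j (Fin.lt_def.2 (by simp; omega))).1 h1
      simp only at this
      omega
  intro i j h
  rcases lt_trichotomy i j with hij | hij | hij
  · exact absurd h (key _ _ hij)
  · exact hij
  · exact absurd h.symm (key _ _ hij)

theorem IsUnitPath.le_of_isCompetitive (hN : ∀ x, N x = 0 → x = 0)
    (hCN : ∀ v w, (translateBy C v ∩ translateBy C w).Nonempty ↔ N (v - w) ≤ 1) {n : ℕ}
    {P : Fin (n + 3) → Plane} (hP : IsUnitPath N P)
    {A : OnlineCDSAlgorithm (intersectionGraph (translates C))} {c : ℝ} (hA : A.IsCompetitive c) :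
    ((n + 2 : ℕ) : ℝ) ≤ c := by
  have hinj := translate_injective hN hCN
  let T : Plane → translates C := fun x => ⟨translateBy C x, translate_mem_translates C x⟩
  have hT : ∀ x y, T x = T y ↔ x = y := fun x y =>
    ⟨fun h => hinj (congrArg Subtype.val h), fun h => h ▸ rfl⟩
  have hadj : ∀ x y, (intersectionGraph (translates C)).Adj (T x) (T y) ↔ x ≠ y ∧ N (x - y) ≤ 1 :=
    fun x y => and_congr (hT x y).not (hCN x y)
  have hlt : ∀ i j, i < j → j < n + 3 → Fin.ofNat (n + 3) i < Fin.ofNat (n + 3) j :=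
    fun i j hij hj => by
      rw [Fin.lt_def, Fin.val_ofNat, Fin.val_ofNat, Nat.mod_eq_of_lt hj,
        Nat.mod_eq_of_lt (hij.trans hj)]
      exact hij
  have hpath : IsInducedPath (intersectionGraph (translates C))
      (fun i => T (P (Fin.ofNat (n + 3) i))) (n + 3) := by
    refine ⟨fun i j hij hj => ?_, fun i j hij hj => ?_⟩
    · exact (hT _ _).not.2 (hP.injective.ne (hlt i j hij hj).ne)
    · rw [hadj, hP.2 _ _ (hlt i j hij hj), Fin.val_ofNat, Fin.val_ofNat, Nat.mod_eq_of_lt hj,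
        Nat.mod_eq_of_lt (hij.trans hj)]
      exact and_iff_right (hP.injective.ne (hlt i j hij hj).ne)
  refine hpath.le_of_isCompetitive (n := n + 1) (u := T 0) (fun i _ => (hadj _ _).2 ⟨fun h => ?_, ?_⟩) hA
  · have := hP.1 (Fin.ofNat (n + 3) i)
    rw [← h] at this
    simp at this
  · rw [zero_sub, map_neg_eq_map, hP.1]

end Translates

theorem mainTheorem4 (C : Set Plane) (hC : IsConvexObject C) :
    ∃ ζ : ℕ, IsIndependentKissingNumber (translates C) ζ ∧
      ∀ A : OnlineCDSAlgorithm (intersectionGraph (translates C)),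
        ((2 * ((ζ : ℝ) - 1) : ℝ) : EReal) ≤ A.competitiveRatio := by
  obtain ⟨N, hN, hc, hCN⟩ := hC.exists_seminorm
  obtain ⟨ζ, hζ5, hζ⟩ := exists_isIndependentKissingNumber hN hc hCN
  refine ⟨ζ, hζ, fun A => le_sInf ?_⟩
  rintro _ ⟨c, hA, rfl⟩
  rw [EReal.coe_le_coe_iff]
  -- Nine points give 8, exactly `2 * (5 - 1)`; seven give 6, enough for every `ζ ≤ 4`.
  rcases hζ5.eq_or_lt with rfl | h
  · obtain ⟨u, hu, h⟩ := hζ.1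
    obtain ⟨f, hf, hd⟩ := h.exists_separated hN hCN hu (by norm_num)
    obtain ⟨P, hP⟩ := exists_unitPath_nine hN hc hf hd
    have := hP.le_of_isCompetitive hN hCN hA
    norm_num at this ⊢
    exact this
  · obtain ⟨P, hP⟩ := exists_unitPath_seven hN hc
    have := hP.le_of_isCompetitive hN hCN hA
    have h4 : (ζ : ℝ) ≤ 4 := by exact_mod_cast Nat.lt_succ_iff.1 h
    norm_num at this
    linarith
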